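/- **Setting (bandit survey problem).** There are finitely many crowds and a finite set of options. Crowd $i$ has a response distribution $\mathcal{D}_i$ over the options and a known per-round cost $c_i>0$; some option $x^*$ is the unique most probable option of every $\mathcal{D}_i$. In each round $t=1,2,\dots$ an algorithm chooses a crowd and receives an independent sample from its response distribution. The gap of a probability distribution is the difference between its largest and its second-largest probability; $\epsilon_i>0$ is the gap of $\mathcal{D}_i$, and $f_i=\epsilon_i/\sqrt{c_i}$. A *single-crowd stopping rule* $R_0$ (possibly randomized) receives one option per round and then decides whether to stop; it is *symmetric* if its probability of stopping at a round, given the observations so far, does not change when the options are permuted. For a crowd-selection algorithm $\mathcal{A}$, $\mathrm{cost}(\mathcal{A}|R_0)$ is the expected total cost $\mathbb{E}\sum_t c_{i_t}$ (where $i_t$ is the crowd chosen in round $t$) when $\mathcal{A}$ is run until the composite stopping rule stops. The composite rule consists of one instance of $R_0$ for each crowd, fed with the answers of that crowd, and one instance for the total crowd, fed with all answers, all with independent random seeds; it stops as soon as some instance stops. $\mathrm{cost}(i|R_0)$ is the expected total cost of always choosing crowd $i$ with a single instance of $R_0$ as the stopping rule. The algorithm $\mathrm{UCB}$ chooses in each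 round $t$ a crowd (ties broken arbitrarily, possibly at random) that maximizes the index $$I_{i,t}=c_i^{-1/2}\left(\tilde\epsilon_{i,t}+\frac{\sqrt{8\log t}}{\sqrt{N_{i,t}}}\right),$$ where $N_{i,t}$ is the number of rounds before $t$ in which crowd $i$ was chosen and $\tilde\epsilon_{i,t}$ is the gap of the empirical distribution of its answers in those rounds; $I_{i,t}=+\infty$ if $N_{i,t}=0$. **Theorem.** For all reals $0<a\le b$ there is a constant $K>0$, depending only on $a$ and $b$, such that the following holds for every instance with costs $c_i\in[a,b]$. Suppose that $c_i/\epsilon_i^2$ has a unique minimizer $i^*$ (the approximate best crowd). Let $R_0$ be a symmetric single-crowd stopping rule that always stops after at most $T$ rounds, where $T\ge 2$. Then $$\mathrm{cost}(\mathrm{UCB}|R_0)\le \mathrm{cost}(i^*|R_0)+K\,\Lambda\log T,\qquad \Lambda=\sum_{i\ne i^*}\bigl(c_i(f_{i^*}-f_i)\bigr)^{-2}.$$ In particular $K$ does not depend on the number of crowds, the number of options, the response distributions, $R_0$ or $T$; it is an absolute constant if all costs equal $1$. -/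

import Mathlib

open scoped ENNReal

noncomputable section

namespace BanditSurvey

universe u v

/-- The gap of a real-valued function `p` on a finite set (a probability vector):
the largest value minus the second-largest value, the values being counted with multiplicity.
The second-largest value is the supremum of `min (p x) (p y)` over all pairs `x ≠ y`
(see `gap_eq`). -/
def gap {O : Type v} (p : O → ℝ) : ℝ :=
  (⨆ x, p x) - ⨆ q : {q : O × O // q.1 ≠ q.2}, min (p q.1.1) (p q.1.2)

/-- If `x` carries the largest value and `y` the largest value among the others, then the gap
is `p x - p y`. -/
theorem gap_eq {O : Type v} (p : O → ℝ) {x y : O} (hxy : x ≠ y)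
    (hx : ∀ z, p z ≤ p x) (hy : ∀ z, z ≠ x → p z ≤ p y) : gap p = p x - p y := by
  have : Nonempty O := ⟨x⟩
  have : Nonempty {q : O × O // q.1 ≠ q.2} := ⟨⟨(x, y), hxy⟩⟩
  have h1 : (⨆ z, p z) = p x :=
    le_antisymm (ciSup_le hx) (le_ciSup (f := p) ⟨p x, by rintro _ ⟨z, rfl⟩; exact hx z⟩ x)
  have hb : ∀ q : {q : O × O // q.1 ≠ q.2}, min (p q.1.1) (p q.1.2) ≤ p y := by
    rintro ⟨⟨a, b⟩, hab⟩
    by_cases ha : a = x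
    · exact (min_le_right _ _).trans (hy b (fun hb => hab (ha.trans hb.symm)))
    · exact (min_le_left _ _).trans (hy a ha)
  have h2 : (⨆ q : {q : O × O // q.1 ≠ q.2}, min (p q.1.1) (p q.1.2)) = p y := by
    refine le_antisymm (ciSup_le hb) ?_
    have := le_ciSup (f := fun q : {q : O × O // q.1 ≠ q.2} => min (p q.1.1) (p q.1.2))
      ⟨p y, by rintro _ ⟨q, rfl⟩; exact hb q⟩ ⟨(x, y), hxy⟩
    simpa [min_eq_right (hx y)] using this
  rw [gap, h1, h2]

/-- An instance of the bandit survey problem with set of crowds `ι` and set of options `O`: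
response distributions, positive per-round costs, and an option (the correct answer) that is the
unique most probable option for every crowd. -/
structure Instance (ι : Type u) (O : Type v) where
  /-- the response distribution of each crowd -/
  response : ι → PMF O
  /-- the per-round cost of each crowd -/
  cost : ι → ℝ
  cost_pos : ∀ i, 0 < cost i
  /-- the correct answer -/
  correct : O
  correct_unique : ∀ i x, x ≠ correct → response i x < response i correct

/-- A history of the interaction: the pairs (chosen crowd, answer received), NEWEST FIRST. -/
abbrev History (ι : Type u) (O : Type v) := List (ι × O)

/-- A (possibly randomized) crowd-selection algorithm: the distribution of the next crowd, given
the history. -/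
abbrev SelectionAlg (ι : Type u) (O : Type v) := History ι O → PMF ι

/-- A (possibly randomized) stopping rule for the whole process: given the history up to and
including the current round, and given that it has not stopped before this round, the
distribution of the decision whether to stop now (`true` means stop). -/
abbrev StoppingRule (ι : Type u) (O : Type v) := History ι O → PMF Bool

/-- A (possibly randomized) single-crowd stopping rule: given the (nonempty) sequence of
observations so far, newest first, the last one being that of the current round, and given that
the rule has not stopped before, the distribution of the decision whether to stop now. -/
abbrev SingleCrowdRule (O : Type v) := List O → PMF Bool

/-- The rule does not favour one option over another: the stopping probability does not change
if the options are permuted. -/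
def SingleCrowdRule.Symmetric {O : Type v} (R : SingleCrowdRule O) : Prop :=
  ∀ (σ : Equiv.Perm O) (l : List O), R (l.map σ) = R l

/-- The rule must stop after at most `T` rounds: along every sequence of `T` observations, some
nonempty initial part (a suffix, as lists are newest first) makes it stop with certainty. -/
def SingleCrowdRule.StopsBy {O : Type v} (R : SingleCrowdRule O) (T : ℕ) : Prop :=
  ∀ l : List O, l.length = T → ∃ l', l' <:+ l ∧ l' ≠ [] ∧ R l' = PMF.pure true

section
variable {ι : Type u} {O : Type v}

/-- The answers of all crowds together. -/
def allAnswers (h : History ι O) : List O := h.map Prod.snd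

/-- The answers of crowd `i`. -/
def answersOf [DecidableEq ι] (h : History ι O) (i : ι) : List O :=
  (h.filter (fun p => p.1 = i)).map Prod.snd

/-- `R` applied to all inputs, treated as a single data source. -/
def pooledRule (R : SingleCrowdRule O) : StoppingRule ι O := fun h => R (allAnswers h)

/-- The composite stopping rule based on `R`: one instance of `R` for each crowd and one for the
total crowd, with independent random seeds; it stops as soon as some instance stops. In each
round exactly two instances receive an input: that of the crowd chosen in this round, and that of
the total crowd. -/
def compositeRule [DecidableEq ι] (R : SingleCrowdRule O) : StoppingRule ι O
  | [] => PMF.pure false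
  | (i, x) :: h =>
      (R (answersOf ((i, x) :: h) i)).bind fun s =>
        (R (allAnswers ((i, x) :: h))).map fun s' => s || s'

/-- One round of the process. A state is the history together with a flag telling whether the
process has stopped. If it has not stopped, a crowd is chosen, an independent answer is drawn
from its response distribution, and the stopping rule is consulted. -/
def step (P : Instance ι O) (A : SelectionAlg ι O) (S : StoppingRule ι O) :
    History ι O × Bool → PMF (History ι O × Bool)
  | (h, true) => PMF.pure (h, true)
  | (h, false) =>
      (A h).bind fun i => (P.response i).bind fun x =>
        (S ((i, x) :: h)).map fun s => ((i, x) :: h, s)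

/-- The law of the state after (at most) `n` rounds. -/
def run (P : Instance ι O) (A : SelectionAlg ι O) (S : StoppingRule ι O) :
    ℕ → PMF (History ι O × Bool)
  | 0 => PMF.pure ([], false)
  | n + 1 => (run P A S n).bind (step P A S)

/-- The total cost of a history. -/
def totalCost (P : Instance ι O) (h : History ι O) : ℝ := (h.map fun p => P.cost p.1).sum

/-- The expected total cost of `A` run with the stopping rule `S`: the monotone limit, as `n`
tends to infinity, of the expected cost incurred in the first `n` rounds. -/
def expectedCost (P : Instance ι O) (A : SelectionAlg ι O) (S : StoppingRule ι O) : ℝ≥0∞ :=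
  ⨆ n : ℕ, ∑' s : History ι O × Bool, run P A S n s * ENNReal.ofReal (totalCost P s.1)

/-- `cost(A | R₀)`: the expected total cost of the crowd-selection algorithm `A`, run together
with the composite stopping rule based on `R₀`. -/
def costAlg [DecidableEq ι] (P : Instance ι O) (A : SelectionAlg ι O) (R₀ : SingleCrowdRule O) :
    ℝ≥0∞ :=
  expectedCost P A (compositeRule R₀)

/-- `cost(i | R₀)`: the expected total cost of always choosing crowd `i`, with `R₀` as the
stopping rule. -/
def costCrowd (P : Instance ι O) (i : ι) (R₀ : SingleCrowdRule O) : ℝ≥0∞ :=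
  expectedCost P (fun _ => PMF.pure i) (pooledRule R₀)

/-- The gap `ε i` of crowd `i`. -/
def Instance.eps (P : Instance ι O) (i : ι) : ℝ := gap fun x => (P.response i x).toReal

/-- The virtual reward `f i = ε i / √(c i)` of crowd `i`. -/
def Instance.reward (P : Instance ι O) (i : ι) : ℝ := P.eps i / √(P.cost i)

/-- `Λ = ∑_{i ≠ i*} (c i (f i* - f i))⁻²`. -/
def Instance.lam [Fintype ι] [DecidableEq ι] (P : Instance ι O) (istar : ι) : ℝ :=
  ∑ i ∈ Finset.univ.erase istar, ((P.cost i * (P.reward istar - P.reward i)) ^ 2)⁻¹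

/-- The number of rounds of `h` in which crowd `i` has been chosen. -/
def numSamples [DecidableEq ι] (h : History ι O) (i : ι) : ℕ := (answersOf h i).length

/-- The empirical gap of crowd `i`: the gap of its empirical distribution. -/
def empGap [DecidableEq ι] [DecidableEq O] (h : History ι O) (i : ι) : ℝ :=
  gap fun x => ((answersOf h i).count x : ℝ) / (numSamples h i : ℝ)

/-- The index of crowd `i` in round `t`, where `h` is the history of the `t - 1` previous rounds:
`(c i)^(-1/2) * (empirical gap + √(8 log t) / √N)`, and `+∞` if the crowd has not been
chosen yet (`N = 0`). -/
def ucbIndex [DecidableEq ι] [DecidableEq O] (P : Instance ι O) (h : History ι O) (i : ι) :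
    EReal :=
  if numSamples h i = 0 then ⊤
  else (((√(P.cost i))⁻¹ *
    (empGap h i + √(8 * Real.log ((h.length + 1 : ℕ) : ℝ)) / √(numSamples h i : ℝ)) : ℝ) : EReal)

/-- `A` is the UCB algorithm with virtual rewards (with any rule, possibly randomized, for
breaking ties): in each round it chooses a crowd that maximizes the index. -/
def IsAlgUCB [DecidableEq ι] [DecidableEq O] (P : Instance ι O) (A : SelectionAlg ι O) : Prop :=
  ∀ h : History ι O, ∀ i ∈ (A h).support, ∀ j, ucbIndex P h j ≤ ucbIndex P h i

end

end BanditSurvey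

end

/-! The total cost of a history is `∑ i, c i * N i`, so it suffices to bound each expected number of
samples `E N i`.

For `i*`, the answers of a crowd are independent samples however the crowds are selected, and the
composite rule stops no later than the instance fed with the answers of `i*`. Hence `E N i*` is at
most the expected stopping time of `R₀` on crowd `i*` alone (`expect_numSamples_le_remaining`), and
this time is paid for by `costCrowd` (`cost_mul_remaining_le_costCrowd`).

For `i ≠ i*`, the usual UCB argument applies to the virtual rewards `f i`: once `N i` exceeds a
multiple of `log T / (c i * (f i* - f i)²)`, choosing `i` requires an inaccurate empirical gap of
`i` or `i*`, and the probabilities of this are summable over the rounds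
(`expect_numSamples_suboptimal_le`). The pooled instance forces a stop by round `T`, so every
logarithm is at most `log T`.

The delicate point is a concentration bound for the empirical gap that is free of the number of
options (`sampleExp_gap_deviation_le`). A plain union bound over the competitors `z` of the correct
option would introduce that number. But a competitor can only do harm if it occurs, so its event may
be weighted by its count; the weighted moment generating function carries a factor `q z`, and these
factors sum to at most `1`. -/

namespace BanditSurvey

universe u v

/-! ### Elementary bounds for the gap. -/

section Gap
variable {O : Type v} [Finite O]

/-- Any pair of distinct options contains one other than `x`. Since `x` need not be a maximizer,
this can be used for an empirical distribution at the true answer. -/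
theorem sub_le_gap (p : O → ℝ) (x : O) {M : ℝ} (hM : 0 ≤ M) (h : ∀ z, z ≠ x → p z ≤ M) :
    p x - M ≤ gap p := by
  have h1 : p x ≤ ⨆ z, p z := le_ciSup (Set.finite_range p).bddAbove x
  have h2 : (⨆ q : {q : O × O // q.1 ≠ q.2}, min (p q.1.1) (p q.1.2)) ≤ M := by
    -- With a single option there are no pairs and the supremum is `0`, which is why `0 ≤ M` is
    -- needed.
    refine Real.iSup_le ?_ hM
    rintro ⟨⟨c, d⟩, hcd⟩
    by_cases hc : c = x
    · exact (min_le_right _ _).trans (h d fun hd => hcd (hc.trans hd.symm))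
    · exact (min_le_left _ _).trans (h c hc)
  unfold gap
  linarith

theorem gap_le_sub_min (p : O → ℝ) {B : ℝ} (hB : ∀ z, p z ≤ B) {x y : O} (hxy : x ≠ y) :
    gap p ≤ B - min (p x) (p y) := by
  have : Nonempty O := ⟨x⟩
  have h1 : (⨆ z, p z) ≤ B := ciSup_le hB
  have h2 := le_ciSup (f := fun q : {q : O × O // q.1 ≠ q.2} => min (p q.1.1) (p q.1.2))
    (Set.finite_range _).bddAbove ⟨(x, y), hxy⟩
  unfold gap
  simp only at h2
  linarith

theorem gap_le_of_nonneg {O : Type v} [Nonempty O] (p : O → ℝ) {B : ℝ} (hB : ∀ z, p z ≤ B)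
    (hp : ∀ z, 0 ≤ p z) : gap p ≤ B := by
  have h1 : (⨆ z, p z) ≤ B := ciSup_le hB
  have h2 : 0 ≤ ⨆ q : {q : O × O // q.1 ≠ q.2}, min (p q.1.1) (p q.1.2) :=
    Real.iSup_nonneg fun q => le_min (hp _) (hp _)
  unfold gap
  linarith

theorem gap_nonneg [Nonempty O] (p : O → ℝ) (hp : ∀ z, 0 ≤ p z) : 0 ≤ gap p := by
  obtain ⟨x, hx⟩ := Finite.exists_max p
  have := sub_le_gap p x (hp x) fun z _ => hx z
  linarith

/-- The second-largest value of a nonnegative function with maximizer `x`; it is `0` if there is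
no second point. -/
theorem exists_second_value (p : O → ℝ) (hp : ∀ z, 0 ≤ p z) (x : O) (hx : ∀ z, p z ≤ p x) :
    ∃ m y, 0 ≤ m ∧ gap p = p x - m ∧ (∀ z, z ≠ x → p z ≤ m) ∧ (m = 0 ∨ (y ≠ x ∧ p y = m)) := by
  have : Nonempty O := ⟨x⟩
  by_cases h : ∃ z, z ≠ x
  · have : Nonempty {z // z ≠ x} := ⟨⟨h.choose, h.choose_spec⟩⟩
    obtain ⟨⟨y, hy⟩, hmax⟩ := Finite.exists_max fun z : {z // z ≠ x} => p z
    have hmax' : ∀ z, z ≠ x → p z ≤ p y := fun z hz => hmax ⟨z, hz⟩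
    exact ⟨p y, y, hp y, gap_eq p hy.symm hx hmax', hmax', Or.inr ⟨hy, rfl⟩⟩
  · push Not at h
    refine ⟨0, x, le_rfl, ?_, fun z hz => absurd (h z) hz, Or.inl rfl⟩
    refine le_antisymm ?_ (sub_le_gap p x le_rfl fun z hz => absurd (h z) hz)
    rw [sub_zero]
    exact gap_le_of_nonneg p hx hp

end Gap

/-! ### Expectations and moment generating functions over independent samples. -/

section Sample
variable {O : Type v} [Fintype O]

/-- The expectation of `F` of the list obtained from `l` by adding `n` independent samples
drawn according to the weights `q`. -/
def sampleExp (q : O → ℝ) : ℕ → (List O → ℝ) → List O → ℝ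
  | 0, F, l => F l
  | n + 1, F, l => ∑ x, q x * sampleExp q n F (x :: l)

theorem sampleExp_mono {q : O → ℝ} (hq : ∀ x, 0 ≤ q x) {F G : List O → ℝ} (n : ℕ) (l : List O)
    (h : ∀ l' : List O, l'.length = l.length + n → F l' ≤ G l') :
    sampleExp q n F l ≤ sampleExp q n G l := by
  induction n generalizing l with
  | zero => exact h l rfl
  | succ n ih =>
    refine Finset.sum_le_sum fun x _ => mul_le_mul_of_nonneg_left (ih _ fun l' hl' => h l' ?_) (hq x)
    rw [hl', List.length_cons]; omega

theorem sampleExp_nonneg {q : O → ℝ} (hq : ∀ x, 0 ≤ q x) {F : List O → ℝ} (hF : ∀ l, 0 ≤ F l)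
    (n : ℕ) (l : List O) : 0 ≤ sampleExp q n F l := by
  induction n generalizing l with
  | zero => exact hF l
  | succ n ih => exact Finset.sum_nonneg fun x _ => mul_nonneg (hq x) (ih _)

theorem sampleExp_add (q : O → ℝ) (F G : List O → ℝ) (n : ℕ) (l : List O) :
    sampleExp q n (fun l => F l + G l) l = sampleExp q n F l + sampleExp q n G l := by
  induction n generalizing l with
  | zero => rfl
  | succ n ih => simp only [sampleExp, ih, mul_add, Finset.sum_add_distrib]

theorem sampleExp_const_mul (q : O → ℝ) (c : ℝ) (F : List O → ℝ) (n : ℕ) (l : List O) :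
    sampleExp q n (fun l => c * F l) l = c * sampleExp q n F l := by
  induction n generalizing l with
  | zero => rfl
  | succ n ih =>
    simp only [sampleExp, ih, Finset.mul_sum]
    exact Finset.sum_congr rfl fun x _ => by ring

theorem sampleExp_sum {κ : Type*} (s : Finset κ) (q : O → ℝ) (F : κ → List O → ℝ) (n : ℕ)
    (l : List O) :
    sampleExp q n (fun l => ∑ k ∈ s, F k l) l = ∑ k ∈ s, sampleExp q n (F k) l := by
  induction n generalizing l with
  | zero => rfl
  | succ n ih =>
    simp only [sampleExp, ih, Finset.mul_sum]
    exact Finset.sum_comm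

variable [DecidableEq O]

theorem sum_mul_ite_ite {q : O → ℝ} (hq1 : ∑ x, q x = 1) {z y : O} (hzy : z ≠ y) (u v w : ℝ) :
    ∑ x, q x * (if x = z then u else if x = y then v else w) =
      w + q z * (u - w) + q y * (v - w) := by
  have : ∀ x, q x * (if x = z then u else if x = y then v else w) =
      q x * w + (if x = z then q x * (u - w) else 0) + (if x = y then q x * (v - w) else 0) := by
    intro x
    by_cases h1 : x = z
    · have h2 : x ≠ y := fun h => hzy (h1.symm.trans h)
      simp [h1, hzy]; ring
    · by_cases h2 : x = y
      · simp [h2, hzy.symm]; ring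
      · simp [h1, h2]
  simp only [this, Finset.sum_add_distrib, ← Finset.sum_mul, hq1, Finset.sum_ite_eq',
    Finset.mem_univ, if_true, one_mul]

theorem sum_mul_ite {q : O → ℝ} (hq1 : ∑ x, q x = 1) (z : O) (u w : ℝ) :
    ∑ x, q x * (if x = z then u else w) = w + q z * (u - w) := by
  have : ∀ x, q x * (if x = z then u else w) =
      q x * w + (if x = z then q x * (u - w) else 0) := by
    intro x
    by_cases h1 : x = z
    · simp [h1]; ring
    · simp [h1]
  simp only [this, Finset.sum_add_distrib, ← Finset.sum_mul, hq1, Finset.sum_ite_eq',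
    Finset.mem_univ, if_true, one_mul]

/-- The moment generating function of the number of occurrences of `z`. -/
theorem sampleExp_pow_count {q : O → ℝ} (hq1 : ∑ x, q x = 1) (z : O) (a : ℝ) (n : ℕ)
    (l : List O) :
    sampleExp q n (fun l => a ^ l.count z) l = a ^ l.count z * (1 + q z * (a - 1)) ^ n := by
  induction n generalizing l with
  | zero => simp [sampleExp]
  | succ n ih =>
    simp only [sampleExp, ih]
    rw [Finset.sum_congr rfl (g := fun x => q x *
      (if x = z then a * (a ^ l.count z * (1 + q z * (a - 1)) ^ n)
        else a ^ l.count z * (1 + q z * (a - 1)) ^ n)), sum_mul_ite hq1]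
    · ring
    · intro x _
      by_cases h : x = z
      · simp only [h, List.count_cons_self, if_true, pow_succ]; ring
      · simp [h, List.count_cons_of_ne h]

/-- A derivative of the joint moment generating function of the numbers of occurrences of `z`
and `y`. -/
theorem sampleExp_count_mul_pow {q : O → ℝ} (hq1 : ∑ x, q x = 1) {z y : O} (hzy : z ≠ y)
    (a b : ℝ) (n : ℕ) (l : List O) :
    sampleExp q n (fun l => (l.count z : ℝ) * (a ^ l.count z * b ^ l.count y)) l =
      a ^ l.count z * b ^ l.count y *
        (l.count z * (1 + q z * (a - 1) + q y * (b - 1)) ^ n +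
          n * (q z * a) * (1 + q z * (a - 1) + q y * (b - 1)) ^ (n - 1)) := by
  set A := 1 + q z * (a - 1) + q y * (b - 1) with hA
  induction n generalizing l with
  | zero => simp [sampleExp]; ring
  | succ n ih =>
    simp only [sampleExp, ih]
    set c := a ^ l.count z * b ^ l.count y with hc
    -- The factor `n` saves the case `n = 0`, where `n - 1` is truncated.
    have hn : (n : ℝ) * A ^ (n - 1) * A = n * A ^ n := by
      rcases n with _ | n
      · simp
      · simp [pow_succ]; ring
    rw [Finset.sum_congr rfl (g := fun x => q x *
      (if x = z then a * c * ((l.count z + 1) * A ^ n + n * (q z * a) * A ^ (n - 1))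
        else if x = y then b * c * (l.count z * A ^ n + n * (q z * a) * A ^ (n - 1))
        else c * (l.count z * A ^ n + n * (q z * a) * A ^ (n - 1)))), sum_mul_ite_ite hq1 hzy]
    · simp only [Nat.add_sub_cancel]
      push_cast
      rw [pow_succ]
      linear_combination (c * q z * a) * hn - (c * (l.count z * A ^ n + n * (q z * a) * A ^ (n - 1))) * hA
    · intro x _
      by_cases h : x = z
      · have : x ≠ y := fun h' => hzy (h.symm.trans h')
        subst h
        simp only [List.count_cons_self, List.count_cons_of_ne this, if_true, pow_succ, hc]
        push_cast
        ring
      · by_cases h' : x = y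
        · subst h'
          simp only [List.count_cons_self, List.count_cons_of_ne h, if_neg h, if_true, pow_succ, hc]
          ring
        · simp [h, h', List.count_cons_of_ne h, List.count_cons_of_ne h', hc]

end Sample

/-! ### Concentration of the empirical gap. -/

/-- Hoeffding's lemma for a random variable with values in `{-1, 0, 1}`. -/
theorem one_add_mul_exp_le {P p : ℝ} (hP : 0 ≤ P) (hp : 0 ≤ p) (hPp : P + p ≤ 1) (s : ℝ) :
    1 + P * (Real.exp s - 1) + p * (Real.exp (-s) - 1) ≤ Real.exp (s * (P - p) + s ^ 2 / 2) := by
  -- The three-point law as a measure; a variable with values in `[-1, 1]` is sub-Gaussian with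
  -- parameter `((1 - (-1)) / 2)² = 1`.
  open MeasureTheory in
  let μ : Measure ℝ := ENNReal.ofReal P • Measure.dirac 1 + ENNReal.ofReal p • Measure.dirac (-1)
    + ENNReal.ofReal (1 - P - p) • Measure.dirac 0
  have hint : ∀ f : ℝ → ℝ, Continuous f → ∫ x, f x ∂μ = P * f 1 + p * f (-1) + (1 - P - p) * f 0 := by
    intro f hf
    have hd : ∀ x : ℝ, Integrable f (Measure.dirac x) := fun x => integrable_dirac (by simp)
    have hs : ∀ (c x : ℝ), Integrable f (ENNReal.ofReal c • Measure.dirac x) := fun c x =>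
      (hd x).smul_measure ENNReal.ofReal_ne_top
    rw [integral_add_measure ((hs _ _).add_measure (hs _ _)) (hs _ _),
      integral_add_measure (hs _ _) (hs _ _)]
    simp [integral_smul_measure, hP, hp, ENNReal.toReal_ofReal (show 0 ≤ 1 - P - p by linarith)]
  have : IsProbabilityMeasure μ := ⟨by
    simp only [μ, Measure.add_apply, Measure.smul_apply, measure_univ, smul_eq_mul, mul_one]
    rw [← ENNReal.ofReal_add hP hp, ← ENNReal.ofReal_add (by positivity) (by linarith)]
    simp⟩
  have hmem : ∀ᵐ x ∂μ, (id x : ℝ) ∈ Set.Icc (-1 : ℝ) 1 := by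
    have hm : MeasurableSet {x : ℝ | ¬ (id x ∈ Set.Icc (-1 : ℝ) 1)} := by
      exact (measurableSet_Icc (a := (-1 : ℝ)) (b := 1)).compl
    rw [ae_iff]
    simp only [μ, Measure.add_apply, Measure.smul_apply, smul_eq_mul]
    rw [Measure.dirac_apply' _ hm, Measure.dirac_apply' _ hm, Measure.dirac_apply' _ hm]
    simp
  have hsub := ProbabilityTheory.hasSubgaussianMGF_of_mem_Icc (μ := μ) (X := id)
    aemeasurable_id hmem
  have h := hsub.mgf_le s
  have hmean : ∫ x, id x ∂μ = P - p := by
    rw [hint id continuous_id]; simp; ring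
  rw [ProbabilityTheory.mgf, hmean,
    hint (fun x => Real.exp (s * (id x - (P - p)))) (by fun_prop)] at h
  have hc : (((‖(1 : ℝ) - (-1)‖₊ / 2) ^ 2 : NNReal) : ℝ) = 1 := by
    push_cast; norm_num
  rw [hc] at h
  have e : ∀ x : ℝ, Real.exp (s * (id x - (P - p))) = Real.exp (s * x) / Real.exp (s * (P - p)) := by
    intro x; rw [← Real.exp_sub]; congr 1; simp; ring
  simp only [e] at h
  have hpos := Real.exp_pos (s * (P - p))
  rw [Real.exp_add]
  have h' := mul_le_mul_of_nonneg_left h hpos.le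
  have : Real.exp (s * (P - p)) * (P * (Real.exp (s * 1) / Real.exp (s * (P - p))) +
      p * (Real.exp (s * -1) / Real.exp (s * (P - p))) +
      (1 - P - p) * (Real.exp (s * 0) / Real.exp (s * (P - p)))) =
      1 + P * (Real.exp s - 1) + p * (Real.exp (-s) - 1) := by
    field_simp
    simp
    ring
  rw [this] at h'
  simpa using h'

section Concentration
variable {O : Type v} [Fintype O] [DecidableEq O]

/-- Deterministic part of the concentration of the empirical gap `gap e` around `gap q`. -/
theorem gap_bounds_of_close {q e : O → ℝ} (he : ∀ x, 0 ≤ e x) {x₀ y : O}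
    {m r : ℝ} (hr : 0 ≤ r) (hm : 0 ≤ m) (hgap : gap q = q x₀ - m) (hmx : m ≤ q x₀)
    (hy : m = 0 ∨ (y ≠ x₀ ∧ q y = m))
    (h1 : ∀ z, z ≠ x₀ → e z - e x₀ ≤ r - gap q) (h2 : q x₀ - r ≤ e x₀) (h3 : e x₀ ≤ q x₀ + r)
    (h4 : q y - r ≤ e y) :
    gap q - r ≤ gap e ∧ gap e ≤ gap q + 3 * r := by
  have : Nonempty O := ⟨x₀⟩
  constructor
  · have hM : 0 ≤ e x₀ + (r - gap q) := by linarith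
    have := sub_le_gap e x₀ hM fun z hz => by linarith [h1 z hz]
    linarith
  · have hB : ∀ z, e z ≤ q x₀ + 2 * r := by
      intro z
      by_cases hz : z = x₀
      · rw [hz]; linarith
      · linarith [h1 z hz]
    rcases hy with hm0 | ⟨hyx, hqy⟩
    · linarith [gap_le_of_nonneg e hB he]
    · have := gap_le_sub_min e hB hyx
      have hmin : m - r ≤ min (e y) (e x₀) := le_min (by linarith) (by linarith)
      linarith

/-- The empirical distribution of a list. -/
noncomputable def empirical (l : List O) (x : O) : ℝ := (l.count x : ℝ) / (l.length : ℝ)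

omit [Fintype O] in
theorem empirical_nonneg (l : List O) (x : O) : 0 ≤ empirical l x := by
  unfold empirical; positivity

theorem sum_empirical {l : List O} (hl : 0 < l.length) : ∑ x, empirical l x = 1 := by
  have h : (0 : ℝ) < l.length := by exact_mod_cast hl
  have h2 : ∑ x, l.count x = l.length := by
    simpa using Multiset.sum_count_eq_card (s := Finset.univ) (m := (l : Multiset O)) (by simp)
  simp only [empirical]
  rw [← Finset.sum_div, ← Nat.cast_sum, h2, div_self h.ne']

theorem chernoff_factor_le {q r : ℝ} (hq : 0 ≤ q) (hq1 : q ≤ 1) (n : ℕ) :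
    Real.exp (r * n * (q - r)) * (1 + q * (Real.exp (-r) - 1)) ^ n ≤
      Real.exp (-(n * r ^ 2 / 2)) := by
  have h := one_add_mul_exp_le le_rfl hq (by linarith) r
  have h0 : 0 ≤ 1 + q * (Real.exp (-r) - 1) := by nlinarith [Real.exp_pos (-r)]
  calc _ ≤ Real.exp (r * n * (q - r)) * Real.exp (r * (0 - q) + r ^ 2 / 2) ^ n := by
        gcongr; linarith
    _ = _ := by
        rw [← Real.exp_nat_mul, ← Real.exp_add]; congr 1; ring

/-- The probability that some option `z ≠ x₀` occurs and exceeds its expected lead. -/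
theorem sum_maximal_factor_le {q : O → ℝ} (hq : ∀ x, 0 ≤ q x) (hq1 : ∑ x, q x = 1) {x₀ : O}
    {m r : ℝ} (hr : 0 ≤ r) (hr1 : r ≤ 1) (hm : 0 ≤ m) (hmx : m ≤ q x₀) (hmq : m + q x₀ ≤ 1)
    (hqm : ∀ z, z ≠ x₀ → q z ≤ m) (n : ℕ) :
    ∑ z ∈ Finset.univ.erase x₀, Real.exp (-(r * n * (r - (q x₀ - m)))) *
      (n * (q z * Real.exp r) *
        (1 + q z * (Real.exp r - 1) + q x₀ * (Real.exp (-r) - 1)) ^ (n - 1)) ≤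
      8 * n * Real.exp (-(n * r ^ 2 / 2)) := by
  have hexp : Real.exp 2 ≤ 8 := by
    have := Real.exp_one_lt_d9
    have h2 : Real.exp 2 = Real.exp 1 * Real.exp 1 := by rw [← Real.exp_add]; norm_num
    rw [h2]; nlinarith [Real.exp_pos 1]
  have hterm : ∀ z ∈ Finset.univ.erase x₀, Real.exp (-(r * n * (r - (q x₀ - m)))) *
      (n * (q z * Real.exp r) *
        (1 + q z * (Real.exp r - 1) + q x₀ * (Real.exp (-r) - 1)) ^ (n - 1)) ≤
      q z * (8 * n * Real.exp (-(n * r ^ 2 / 2))) := by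
    intro z hz
    have hz' := hqm z (Finset.ne_of_mem_erase hz)
    have hA0 : 0 ≤ 1 + q z * (Real.exp r - 1) + q x₀ * (Real.exp (-r) - 1) := by
      have := mul_nonneg (hq z) (sub_nonneg.2 (Real.one_le_exp hr))
      nlinarith [Real.exp_pos (-r), hq x₀]
    -- Only the base is weakened from `q z` to `m`; the leading factor `q z` is kept for the
    -- summation over `z`.
    have hA : 1 + q z * (Real.exp r - 1) + q x₀ * (Real.exp (-r) - 1) ≤
        Real.exp (r * (m - q x₀) + r ^ 2 / 2) := by
      refine le_trans ?_ (one_add_mul_exp_le hm (hq x₀) hmq r)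
      have := mul_le_mul_of_nonneg_right hz' (sub_nonneg.2 (Real.one_le_exp hr))
      linarith
    rcases n with _ | n
    · simp
    simp only [Nat.add_sub_cancel]
    calc _ ≤ Real.exp (-(r * (n + 1 : ℕ) * (r - (q x₀ - m)))) *
          ((n + 1 : ℕ) * (q z * Real.exp r) * Real.exp (r * (m - q x₀) + r ^ 2 / 2) ^ n) := by
          have := hq z
          gcongr
      _ = q z * ((n + 1 : ℕ) * (Real.exp (r + r * (q x₀ - m) - r ^ 2 / 2) *
          Real.exp (-((n + 1 : ℕ) * r ^ 2 / 2)))) := by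
          rw [← Real.exp_nat_mul]
          have : ∀ A B C D N Q : ℝ, A * (N * (Q * B) * C) = Q * (N * (A * B * C)) := by
            intros; ring
          rw [this _ _ _ 0, ← Real.exp_add, ← Real.exp_add, ← Real.exp_add]
          congr 3
          push_cast
          ring
      _ ≤ q z * ((n + 1 : ℕ) * (8 * Real.exp (-((n + 1 : ℕ) * r ^ 2 / 2)))) := by
          have := hq z
          -- What remains from the factor `exp r` and the power `n - 1` in place of `n`: as `r` and
          -- `q x₀ - m` are at most `1`, the exponent is at most `2`.
          have h8 : Real.exp (r + r * (q x₀ - m) - r ^ 2 / 2) ≤ 8 := by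
            refine le_trans (Real.exp_le_exp.2 ?_) hexp
            nlinarith [sq_nonneg r]
          gcongr
      _ = _ := by ring
  refine (Finset.sum_le_sum hterm).trans ?_
  rw [← Finset.sum_mul]
  have hs : ∑ z ∈ Finset.univ.erase x₀, q z ≤ 1 := by
    rw [← hq1]
    exact Finset.sum_le_sum_of_subset_of_nonneg (Finset.erase_subset _ _) fun z _ _ => hq z
  exact mul_le_of_le_one_left (by positivity) hs

/-- The sign of `r` is free: positive `r` serves the lower tail of the count, negative `r` the upper
tail. -/
theorem sampleExp_chernoff {q : O → ℝ} (hq : ∀ x, 0 ≤ q x) (hq1 : ∑ x, q x = 1) (z : O) (r : ℝ)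
    (n : ℕ) :
    sampleExp q n (fun l => Real.exp (r * n * (q z - r)) * Real.exp (-r) ^ l.count z) [] ≤
      Real.exp (-(n * r ^ 2 / 2)) := by
  have hz1 : q z ≤ 1 := hq1 ▸ Finset.single_le_sum (fun x _ => hq x) (Finset.mem_univ z)
  rw [sampleExp_const_mul, sampleExp_pow_count hq1]
  simpa using chernoff_factor_le (hq z) hz1 n

/-- Concentration of the gap of the empirical distribution of `n` independent samples. The bound
does not depend on the number of options. -/
theorem sampleExp_gap_deviation_le {q : O → ℝ} (hq : ∀ x, 0 ≤ q x) (hq1 : ∑ x, q x = 1) (x₀ : O)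
    (hx₀ : ∀ z, q z ≤ q x₀) {n : ℕ} (hn : 0 < n) {r : ℝ} (hr : 0 ≤ r) :
    sampleExp q n (fun l => if gap q - r ≤ gap (empirical l) ∧ gap (empirical l) ≤ gap q + 3 * r
      then 0 else 1) [] ≤ 11 * n * Real.exp (-(n * r ^ 2 / 2)) := by
  have : Nonempty O := ⟨x₀⟩
  have hnR : (0 : ℝ) < n := by exact_mod_cast hn
  have hle1 : ∀ p : O → ℝ, (∀ x, 0 ≤ p x) → ∑ x, p x = 1 → ∀ x, p x ≤ 1 := fun p hp hp1 x =>
    hp1 ▸ Finset.single_le_sum (fun x _ => hp x) (Finset.mem_univ x)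
  obtain ⟨m, y, hm, hgap, hqm, hy⟩ := exists_second_value q hq x₀ hx₀
  have hmx : m ≤ q x₀ := by
    rcases hy with h | ⟨_, h⟩
    · rw [h]; exact hq _
    · rw [← h]; exact hx₀ y
  have hmq : m + q x₀ ≤ 1 := by
    rcases hy with h | ⟨hne, h⟩
    · rw [h, zero_add]; exact hle1 q hq hq1 _
    · rw [← h, ← hq1, ← Finset.sum_pair hne]
      exact Finset.sum_le_sum_of_subset_of_nonneg (Finset.subset_univ _) fun z _ _ => hq z
  rcases le_or_gt r 1 with hr1 | hr1
  swap
  -- For `r > 1` a deviation is impossible, since both gaps lie in `[0, 1]`.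
  · have h0 : sampleExp q n (fun l => if gap q - r ≤ gap (empirical l) ∧
        gap (empirical l) ≤ gap q + 3 * r then 0 else 1) [] ≤
        sampleExp q n (fun _ => 0 * (0 : ℝ)) [] := by
      refine sampleExp_mono hq n [] fun l hl => ?_
      have hl0 : 0 < l.length := by simpa [hl] using hn
      have hg0 := gap_nonneg (empirical l) (empirical_nonneg l)
      have hg1 := gap_le_of_nonneg (empirical l)
        (hle1 _ (empirical_nonneg l) (sum_empirical hl0)) (empirical_nonneg l)
      rw [if_pos ⟨by linarith [hle1 q hq hq1 x₀], by linarith⟩, zero_mul]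
    refine h0.trans ?_
    rw [sampleExp_const_mul, zero_mul]
    positivity
  set a := Real.exp r with ha
  set b := Real.exp (-r) with hb
  -- Exponential Markov bound: each way in which `gap_bounds_of_close` can fail makes one summand at
  -- least `1`.
  have hmain : sampleExp q n (fun l => if gap q - r ≤ gap (empirical l) ∧
        gap (empirical l) ≤ gap q + 3 * r then 0 else 1) [] ≤
      sampleExp q n (fun l => ((∑ z ∈ Finset.univ.erase x₀, Real.exp (-(r * n * (r - (q x₀ - m)))) *
        ((l.count z : ℝ) * (a ^ l.count z * b ^ l.count x₀))) +
        Real.exp (r * n * (q x₀ - r)) * b ^ l.count x₀) +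
        (Real.exp (-(r * n * (q x₀ + r))) * a ^ l.count x₀ +
        Real.exp (r * n * (q y - r)) * b ^ l.count y)) [] := by
    refine sampleExp_mono hq n [] fun l hl => ?_
    have hl : l.length = n := by simpa using hl
    have hs0 : ∀ z ∈ Finset.univ.erase x₀, 0 ≤ Real.exp (-(r * n * (r - (q x₀ - m)))) *
        ((l.count z : ℝ) * (a ^ l.count z * b ^ l.count x₀)) := fun z _ => by positivity
    have hS := Finset.sum_nonneg hs0
    have h20 : 0 ≤ Real.exp (r * n * (q x₀ - r)) * b ^ l.count x₀ := by positivity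
    have h30 : 0 ≤ Real.exp (-(r * n * (q x₀ + r))) * a ^ l.count x₀ := by positivity
    have h40 : 0 ≤ Real.exp (r * n * (q y - r)) * b ^ l.count y := by positivity
    split_ifs with hgood
    · linarith
    have hemp : ∀ x, empirical l x = l.count x / n := fun x => by rw [empirical, hl]
    have hlow : ∀ x, empirical l x < q x - r →
        1 ≤ Real.exp (r * n * (q x - r)) * b ^ l.count x := by
      intro x hx
      rw [hemp, div_lt_iff₀ hnR] at hx
      rw [hb, ← Real.exp_nat_mul, ← Real.exp_add]
      refine Real.one_le_exp ?_
      nlinarith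
    by_cases h2 : q x₀ - r ≤ empirical l x₀
    swap
    · linarith [hlow x₀ (not_le.1 h2)]
    by_cases h4 : q y - r ≤ empirical l y
    swap
    · linarith [hlow y (not_le.1 h4)]
    by_cases h3 : empirical l x₀ ≤ q x₀ + r
    swap
    · have h3' := not_le.1 h3
      rw [hemp, lt_div_iff₀ hnR] at h3'
      have : 1 ≤ Real.exp (-(r * n * (q x₀ + r))) * a ^ l.count x₀ := by
        rw [ha, ← Real.exp_nat_mul, ← Real.exp_add]
        refine Real.one_le_exp ?_
        nlinarith
      linarith
    have h1 : ¬ ∀ z, z ≠ x₀ → empirical l z - empirical l x₀ ≤ r - gap q := fun h1 =>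
      hgood (gap_bounds_of_close (empirical_nonneg l) hr hm hgap hmx hy
        h1 h2 h3 h4)
    push Not at h1
    obtain ⟨z, hz, h1⟩ := h1
    -- As `x₀` is not too rare, an absent option cannot violate the bound on its lead; hence the
    -- weight `count z` is at least `1`.
    have hcz : 1 ≤ l.count z := by
      by_contra hc
      have : l.count z = 0 := by omega
      rw [hemp z, this] at h1
      simp only [Nat.cast_zero, zero_div] at h1
      linarith
    have hczR : (1 : ℝ) ≤ l.count z := by exact_mod_cast hcz
    rw [hemp, hemp, ← sub_div, lt_div_iff₀ hnR, hgap] at h1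
    have hone : 1 ≤ Real.exp (-(r * n * (r - (q x₀ - m)))) *
        ((l.count z : ℝ) * (a ^ l.count z * b ^ l.count x₀)) := by
      have : 1 ≤ Real.exp (-(r * n * (r - (q x₀ - m)))) * (a ^ l.count z * b ^ l.count x₀) := by
        rw [ha, hb, ← Real.exp_nat_mul, ← Real.exp_nat_mul, ← Real.exp_add, ← Real.exp_add]
        refine Real.one_le_exp ?_
        nlinarith
      nlinarith
    have := Finset.single_le_sum hs0 (Finset.mem_erase.2 ⟨hz, Finset.mem_univ z⟩)
    linarith
  refine hmain.trans ?_
  rw [sampleExp_add, sampleExp_add, sampleExp_add, sampleExp_sum]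
  have e1 := sum_maximal_factor_le hq hq1 hr hr1 hm hmx hmq hqm n
  have e2 := sampleExp_chernoff hq hq1 x₀ r n
  have e4 := sampleExp_chernoff hq hq1 y r n
  have e3 : sampleExp q n (fun l => Real.exp (-(r * n * (q x₀ + r))) * a ^ l.count x₀) [] ≤
      Real.exp (-(n * r ^ 2 / 2)) := by
    have := sampleExp_chernoff hq hq1 x₀ (-r) n
    have h' : -r * n * (q x₀ - -r) = -(r * n * (q x₀ + r)) := by ring
    rw [neg_neg, h', neg_sq] at this
    exact this
  rw [Finset.sum_congr rfl (g := fun z => Real.exp (-(r * n * (r - (q x₀ - m)))) *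
      (n * (q z * a) * (1 + q z * (a - 1) + q x₀ * (b - 1)) ^ (n - 1))) fun z hz => by
    rw [sampleExp_const_mul, sampleExp_count_mul_pow hq1 (Finset.ne_of_mem_erase hz)]
    simp]
  -- The three single-option tails contribute one exponential each, and `8 n + 3 ≤ 11 n`.
  have hn1 : (1 : ℝ) ≤ n := by exact_mod_cast hn
  have hE := Real.exp_pos (-(n * r ^ 2 / 2))
  nlinarith

end Concentration

/-! ### Expectations with respect to a `PMF`. -/

section Expectation
variable {α β : Type*}

/-- The expectation of a nonnegative function. -/
noncomputable def expect (μ : PMF α) (F : α → ℝ≥0∞) : ℝ≥0∞ := ∑' a, μ a * F a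

theorem expect_pure (a : α) (F : α → ℝ≥0∞) : expect (PMF.pure a) F = F a := by
  classical
  rw [expect, tsum_eq_single a fun b hb => by simp [PMF.pure_apply, hb]]
  simp

theorem expect_bind (μ : PMF α) (f : α → PMF β) (F : β → ℝ≥0∞) :
    expect (μ.bind f) F = expect μ fun a => expect (f a) F := by
  simp only [expect, PMF.bind_apply, ← ENNReal.tsum_mul_right, ← ENNReal.tsum_mul_left]
  rw [ENNReal.tsum_comm]
  simp only [mul_assoc]

theorem expect_map (μ : PMF α) (f : α → β) (F : β → ℝ≥0∞) :
    expect (μ.map f) F = expect μ (F ∘ f) := by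
  rw [← PMF.bind_pure_comp, expect_bind]
  simp only [Function.comp_def, expect_pure]

theorem expect_mono_support {μ : PMF α} {F G : α → ℝ≥0∞} (h : ∀ a ∈ μ.support, F a ≤ G a) :
    expect μ F ≤ expect μ G := by
  refine ENNReal.tsum_le_tsum fun a => ?_
  by_cases ha : a ∈ μ.support
  · gcongr; exact h a ha
  · rw [PMF.mem_support_iff, not_not] at ha; simp [ha]

theorem expect_mono {μ : PMF α} {F G : α → ℝ≥0∞} (h : ∀ a, F a ≤ G a) :
    expect μ F ≤ expect μ G :=
  expect_mono_support fun a _ => h a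

theorem expect_add (μ : PMF α) (F G : α → ℝ≥0∞) :
    expect μ (fun a => F a + G a) = expect μ F + expect μ G := by
  simp only [expect, mul_add, ENNReal.tsum_add]

theorem expect_const_mul (μ : PMF α) (c : ℝ≥0∞) (F : α → ℝ≥0∞) :
    expect μ (fun a => c * F a) = c * expect μ F := by
  simp only [expect, ← ENNReal.tsum_mul_left]
  exact tsum_congr fun a => by ring

theorem expect_const (μ : PMF α) (c : ℝ≥0∞) : expect μ (fun _ => c) = c := by
  rw [expect, ENNReal.tsum_mul_right, PMF.tsum_coe, one_mul]

theorem expect_finsetSum {κ : Type*} (s : Finset κ) (μ : PMF α) (F : κ → α → ℝ≥0∞) :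
    expect μ (fun a => ∑ k ∈ s, F k a) = ∑ k ∈ s, expect μ (F k) := by
  classical
  induction s using Finset.induction_on with
  | empty => simpa using expect_const μ 0
  | insert k s hk ih => simp only [Finset.sum_insert hk, expect_add, ih]

theorem expect_bool (μ : PMF Bool) (F : Bool → ℝ≥0∞) :
    expect μ F = μ false * F false + μ true * F true := by
  rw [expect, tsum_bool]

theorem expect_ofReal [Fintype α] (μ : PMF α) {F : α → ℝ} (hF : ∀ a, 0 ≤ F a) :
    expect μ (fun a => ENNReal.ofReal (F a)) = ENNReal.ofReal (∑ a, (μ a).toReal * F a) := by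
  rw [expect, tsum_fintype, ENNReal.ofReal_sum_of_nonneg fun a _ =>
    mul_nonneg ENNReal.toReal_nonneg (hF a)]
  refine Finset.sum_congr rfl fun a _ => ?_
  rw [ENNReal.ofReal_mul ENNReal.toReal_nonneg, ENNReal.ofReal_toReal (μ.apply_ne_top a)]

end Expectation

/-! ### Potentials along a run, and comparison of adaptive with independent sampling. -/

section Runs
variable {ι : Type u} {O : Type v} {P : Instance ι O} {A : SelectionAlg ι O} {S : StoppingRule ι O}

theorem expect_step_true (h : History ι O) (F : History ι O × Bool → ℝ≥0∞) :
    expect (step P A S (h, true)) F = F (h, true) := expect_pure _ _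

theorem expect_step_false (h : History ι O) (F : History ι O × Bool → ℝ≥0∞) :
    expect (step P A S (h, false)) F = expect (A h) fun i => expect (P.response i) fun x =>
      expect (S ((i, x) :: h)) fun s => F ((i, x) :: h, s) := by
  simp only [step, expect_bind, expect_map, Function.comp_def]

theorem expect_run_succ (n : ℕ) (F : History ι O × Bool → ℝ≥0∞) :
    expect (run P A S (n + 1)) F = expect (run P A S n) fun s => expect (step P A S s) F :=
  expect_bind _ _ _

/-- A potential that does not increase in expectation. -/
theorem expect_run_le (Φ : ℕ → History ι O × Bool → ℝ≥0∞) (N : ℕ)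
    (hΦ : ∀ k < N, ∀ s, expect (step P A S s) (Φ (k + 1)) ≤ Φ k s) {k : ℕ} (hk : k ≤ N) :
    expect (run P A S k) (Φ k) ≤ Φ 0 ([], false) := by
  induction k with
  | zero => exact (expect_pure _ _).le
  | succ k ih =>
    rw [expect_run_succ]
    exact (expect_mono fun s => hΦ k hk s).trans (ih (by omega))

/-- A potential that does not decrease in expectation. -/
theorem le_expect_run (Φ : ℕ → History ι O × Bool → ℝ≥0∞) (N : ℕ)
    (hΦ : ∀ k < N, ∀ s, Φ k s ≤ expect (step P A S s) (Φ (k + 1))) {k : ℕ} (hk : k ≤ N) :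
    Φ 0 ([], false) ≤ expect (run P A S k) (Φ k) := by
  induction k with
  | zero => exact (expect_pure _ _).ge
  | succ k ih =>
    rw [expect_run_succ]
    exact (ih (by omega)).trans (expect_mono fun s => hΦ k hk s)

theorem run_support_induction (Q : ℕ → History ι O × Bool → Prop) (h0 : Q 0 ([], false))
    (htrue : ∀ n h, Q n (h, true) → Q (n + 1) (h, true))
    (hfalse : ∀ n h i x s, Q n (h, false) → i ∈ (A h).support → s ∈ (S ((i, x) :: h)).support →
      Q (n + 1) ((i, x) :: h, s)) (n : ℕ) :
    ∀ s ∈ (run P A S n).support, Q n s := by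
  induction n with
  | zero =>
    intro s hs
    rw [run, PMF.support_pure, Set.mem_singleton_iff] at hs
    rwa [hs]
  | succ n ih =>
    intro s hs
    rw [run, PMF.mem_support_bind_iff] at hs
    obtain ⟨⟨h, s'⟩, hs', hs⟩ := hs
    have hQ := ih _ hs'
    cases s' with
    | true =>
      rw [step, PMF.support_pure, Set.mem_singleton_iff] at hs
      rw [hs]
      exact htrue n h hQ
    | false =>
      simp only [step, PMF.mem_support_bind_iff, PMF.mem_support_map_iff] at hs
      obtain ⟨i, hi, x, -, b, hb, rfl⟩ := hs
      exact hfalse n h i x b hQ hi hb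

theorem totalCost_nonneg (P : Instance ι O) (h : History ι O) : 0 ≤ totalCost P h :=
  List.sum_nonneg fun c hc => by
    obtain ⟨p, -, rfl⟩ := List.mem_map.1 hc
    exact (P.cost_pos _).le

theorem totalCost_cons (P : Instance ι O) (p : ι × O) (h : History ι O) :
    totalCost P (p :: h) = P.cost p.1 + totalCost P h := by
  simp [totalCost]

variable [DecidableEq ι]

theorem answersOf_cons_self (i : ι) (x : O) (h : History ι O) :
    answersOf ((i, x) :: h) i = x :: answersOf h i := by
  simp [answersOf]

theorem answersOf_cons_of_ne {i j : ι} (hij : j ≠ i) (x : O) (h : History ι O) :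
    answersOf ((j, x) :: h) i = answersOf h i := by
  simp [answersOf, hij]

theorem numSamples_cons_self (i : ι) (x : O) (h : History ι O) :
    numSamples ((i, x) :: h) i = numSamples h i + 1 := by
  simp [numSamples, answersOf_cons_self]

theorem numSamples_cons_of_ne {i j : ι} (hij : j ≠ i) (x : O) (h : History ι O) :
    numSamples ((j, x) :: h) i = numSamples h i := by
  simp [numSamples, answersOf_cons_of_ne hij]

theorem numSamples_le_length (h : History ι O) (i : ι) : numSamples h i ≤ h.length := by
  simp only [numSamples, answersOf, List.length_map]
  exact List.length_filter_le _ _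

theorem totalCost_eq_sum [Fintype ι] (P : Instance ι O) (h : History ι O) :
    totalCost P h = ∑ i, P.cost i * numSamples h i := by
  induction h with
  | nil => simp [totalCost, numSamples, answersOf]
  | cons p h ih =>
    obtain ⟨j, x⟩ := p
    rw [totalCost_cons, ih]
    have : ∀ i, P.cost i * numSamples ((j, x) :: h) i =
        P.cost i * numSamples h i + if i = j then P.cost i else 0 := by
      intro i
      by_cases hi : i = j
      · subst hi; rw [numSamples_cons_self, if_pos rfl]; push_cast; ring
      · rw [numSamples_cons_of_ne (Ne.symm hi), if_neg hi, add_zero]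
    simp only [this, Finset.sum_add_distrib, Finset.sum_ite_eq', Finset.mem_univ, if_true]
    ring

/-- To continue, both consulted instances must continue; the pooled one is dropped here. -/
theorem compositeRule_false_le (R : SingleCrowdRule O) (i : ι) (x : O) (h : History ι O) :
    compositeRule R ((i, x) :: h) false ≤ R (x :: answersOf h i) false := by
  simp only [compositeRule, answersOf_cons_self]
  rw [PMF.bind_apply, tsum_bool]
  have : (PMF.map (fun s' => true || s') (R (allAnswers ((i, x) :: h)))) false = 0 := by
    simp [PMF.map_apply]
  rw [this, mul_zero, add_zero]
  exact mul_le_of_le_one_right' (PMF.coe_le_one _ _)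

/-- A run that has not stopped after `n` rounds has exactly `n` observations, and `R` did not
stop with certainty on any of the observation sequences of the total crowd. -/
theorem run_compositeRule_support (R : SingleCrowdRule O) (n : ℕ) :
    ∀ s ∈ (run P A (compositeRule R) n).support, s.2 = false → s.1.length = n ∧
      ∀ l', l' <:+ allAnswers s.1 → l' ≠ [] → R l' ≠ PMF.pure true := by
  refine run_support_induction (fun n s => s.2 = false → s.1.length = n ∧
      ∀ l', l' <:+ allAnswers s.1 → l' ≠ [] → R l' ≠ PMF.pure true) ?_ ?_ ?_ n
  · refine fun _ => ⟨rfl, fun l' hl' hne => absurd ?_ hne⟩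
    simpa [allAnswers] using hl'
  · intro n h _ hc
    simp at hc
  · rintro n h i x s hQ - hs rfl
    obtain ⟨hlen, hR⟩ := hQ rfl
    refine ⟨by simp [hlen], fun l' hl' hne hpure => ?_⟩
    have hl'' : l' <:+ x :: allAnswers h := by simpa [allAnswers] using hl'
    rcases List.suffix_cons_iff.1 hl'' with heq | hsuf
    · have heq' : R (allAnswers ((i, x) :: h)) = PMF.pure true := by
        rw [← hpure, heq]; simp [allAnswers]
      simp [compositeRule, heq', PMF.pure_map] at hs
    · exact hR l' hsuf hne hpure

/-- The pooled instance alone enforces the horizon. -/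
theorem lt_of_not_stopped {R : SingleCrowdRule O} {T : ℕ} (hT : R.StopsBy T) {n : ℕ}
    {h : History ι O} (hs : (h, false) ∈ (run P A (compositeRule R) n).support) :
    h.length = n ∧ n < T := by
  obtain ⟨hlen, hR⟩ := run_compositeRule_support R n _ hs rfl
  refine ⟨hlen, ?_⟩
  by_contra hn
  have hlen' : (allAnswers h).length = n := by simpa [allAnswers] using hlen
  -- Lists are newest first, so this keeps the first `T` observations.
  obtain ⟨l', hl', hne, hl⟩ := hT ((allAnswers h).drop (n - T)) (by
    rw [List.length_drop, hlen']; omega)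
  exact hR l' (hl'.trans (List.drop_suffix _ _)) hne hl

/-- The expected number of further rounds, `m` at most, when samples from `q` are added to `l`
until `R` stops. -/
noncomputable def remaining (R : SingleCrowdRule O) (q : PMF O) : ℕ → List O → ℝ≥0∞
  | 0, _ => 0
  | m + 1, l => 1 + expect q fun x => R (x :: l) false * remaining R q m (x :: l)

theorem remaining_le_succ (R : SingleCrowdRule O) (q : PMF O) (m : ℕ) (l : List O) :
    remaining R q m l ≤ remaining R q (m + 1) l := by
  induction m generalizing l with
  | zero => exact zero_le
  | succ m ih =>
    rw [remaining, remaining]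
    gcongr
    exact expect_mono fun x => by gcongr; exact ih _

omit [DecidableEq ι] in
/-- The cost of always choosing crowd `i` is at least the cost of the expected number of rounds. -/
theorem cost_mul_remaining_le_costCrowd (P : Instance ι O) (i : ι) (R : SingleCrowdRule O)
    (m : ℕ) : ENNReal.ofReal (P.cost i) * remaining R (P.response i) m [] ≤ costCrowd P i R := by
  -- Potential: cost so far plus expected cost to go within the horizon `m`. Its second part
  -- vanishes at time `m`, so no limit is needed.
  have h := le_expect_run (P := P) (A := fun _ => PMF.pure i) (S := pooledRule R)
    (fun k s => ENNReal.ofReal (totalCost P s.1) +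
      if s.2 then 0 else ENNReal.ofReal (P.cost i) *
        remaining R (P.response i) (m - k) (allAnswers s.1)) m ?_ le_rfl
  · simp only [totalCost, List.map_nil, List.sum_nil, ENNReal.ofReal_zero, zero_add, allAnswers,
      Bool.false_eq_true, if_false, Nat.sub_zero] at h
    refine h.trans ?_
    refine le_trans ?_ (le_iSup _ m)
    refine expect_mono fun s => ?_
    simp [remaining, totalCost]
  · rintro k hk ⟨h, s⟩
    cases s with
    | true => rw [expect_step_true]; simp
    | false =>
      rw [expect_step_false, expect_pure]
      obtain ⟨j, rfl⟩ : ∃ j, m = k + 1 + j := ⟨m - (k + 1), by omega⟩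
      have e1 : k + 1 + j - k = j + 1 := by omega
      have e2 : k + 1 + j - (k + 1) = j := by omega
      simp only [e1, e2, expect_add, expect_const, expect_bool, Bool.false_eq_true, if_false,
        if_true, mul_zero, add_zero, totalCost_cons, pooledRule, remaining]
      rw [ENNReal.ofReal_add (P.cost_pos i).le (totalCost_nonneg P h)]
      rw [mul_add, mul_one, ← expect_const_mul]
      have : ∀ x, allAnswers ((i, x) :: h) = x :: allAnswers h := fun x => rfl
      simp only [this, mul_left_comm]
      rw [← add_assoc, add_comm (ENNReal.ofReal (totalCost P h))]

/-- With the composite stopping rule, the expected number of rounds in which crowd `i` is chosen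
is bounded by the expected number of rounds of the single instance. -/
theorem expect_numSamples_le_remaining (R : SingleCrowdRule O) (i : ι) (m : ℕ) :
    expect (run P A (compositeRule R) m) (fun s => (numSamples s.1 i : ℝ≥0∞)) ≤
      remaining R (P.response i) m [] := by
  have h := expect_run_le (P := P) (A := A) (S := compositeRule R)
    (fun k s => (numSamples s.1 i : ℝ≥0∞) +
      if s.2 then 0 else remaining R (P.response i) (m - k) (answersOf s.1 i)) m ?_ le_rfl
  · refine (expect_mono fun s => le_self_add).trans (h.trans ?_)
    simp [numSamples, answersOf]
  · rintro k hk ⟨h, s⟩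
    cases s with
    | true => rw [expect_step_true]; simp
    | false =>
      rw [expect_step_false, ← expect_const (A h) (_ + _)]
      obtain ⟨j, rfl⟩ : ∃ j, m = k + 1 + j := ⟨m - (k + 1), by omega⟩
      have e1 : k + 1 + j - k = j + 1 := by omega
      have e2 : k + 1 + j - (k + 1) = j := by omega
      refine expect_mono fun i' => ?_
      simp only [e1, e2, expect_add, expect_const, expect_bool, Bool.false_eq_true, if_false,
        if_true, mul_zero, add_zero]
      by_cases hi : i' = i
      · subst hi
        simp only [numSamples_cons_self, answersOf_cons_self, expect_const, remaining]
        push_cast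
        rw [add_assoc]
        gcongr
        exact expect_mono fun x => by gcongr; exact compositeRule_false_le R i' x h
      -- Another crowd is chosen: the horizon shrinks while the answers of `i` stay the same, and a
      -- stop removes the remainder, so the potential cannot grow.
      · simp only [numSamples_cons_of_ne hi, answersOf_cons_of_ne hi, expect_const]
        gcongr
        rw [← expect_const (P.response i') (remaining _ _ (j + 1) _)]
        refine expect_mono fun x => ?_
        exact (mul_le_of_le_one_left' (PMF.coe_le_one _ _)).trans (remaining_le_succ _ _ _ _)

/-- A function of the answers of crowd `i` that is a supermartingale under independent sampling
is one under adaptive sampling. -/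
theorem expect_run_answersOf_le (i : ι) {F : List O → ℝ≥0∞}
    (hF : ∀ l, expect (P.response i) (fun x => F (x :: l)) ≤ F l) (k : ℕ) :
    expect (run P A S k) (fun s => F (answersOf s.1 i)) ≤ F [] := by
  refine expect_run_le (fun _ s => F (answersOf s.1 i)) k ?_ le_rfl
  rintro k - ⟨h, s⟩
  cases s with
  | true => rw [expect_step_true]
  | false =>
    rw [expect_step_false, ← expect_const (A h) (F _)]
    refine expect_mono fun j => ?_
    by_cases hj : j = i
    · subst hj
      simp only [answersOf_cons_self, expect_const]
      exact hF _
    · simp only [answersOf_cons_of_ne hj, expect_const, le_refl]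

/-- The event that crowd `i` has `n` samples and they satisfy a condition is at most as likely as
the condition is for `n` independent samples. -/
theorem expect_run_of_numSamples_eq_le [Fintype O] (i : ι) {G : List O → ℝ} (hG : ∀ l, 0 ≤ G l)
    (n k : ℕ) :
    expect (run P A S k) (fun s => if numSamples s.1 i = n then
      ENNReal.ofReal (G (answersOf s.1 i)) else 0) ≤
      ENNReal.ofReal (sampleExp (fun x => (P.response i x).toReal) n G []) := by
  set q : O → ℝ := fun x => (P.response i x).toReal with hq
  -- The conditional expectation of `G` at sample size `n`: a martingale up to that size, and `0`
  -- beyond it.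
  let F : List O → ℝ≥0∞ := fun l => if l.length ≤ n then
    ENNReal.ofReal (sampleExp q (n - l.length) G l) else 0
  have hF : ∀ l, expect (P.response i) (fun x => F (x :: l)) ≤ F l := by
    intro l
    simp only [F, List.length_cons]
    by_cases hl : l.length + 1 ≤ n
    · simp only [if_pos hl, if_pos (show l.length ≤ n by omega)]
      rw [expect_ofReal _ fun x => sampleExp_nonneg (fun x => ENNReal.toReal_nonneg) hG _ _]
      have : n - l.length = n - (l.length + 1) + 1 := by omega
      rw [this, sampleExp]
    · simp only [if_neg hl, expect_const, zero_le]
  have := expect_run_answersOf_le (A := A) (S := S) i hF k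
  refine le_trans (expect_mono fun s => ?_) (this.trans (by simp [F]))
  split_ifs with h
  · have h' : (answersOf s.1 i).length = n := h
    simp [F, h', sampleExp]
  · exact zero_le

end Runs

/-! ### Analysis of UCB. -/

section UCB
variable {ι : Type u} {O : Type v} [Fintype ι] [DecidableEq ι] [Fintype O] [DecidableEq O]
  {P : Instance ι O} {A : SelectionAlg ι O} {S : StoppingRule ι O}

omit [Fintype ι] [DecidableEq ι] [DecidableEq O] in
theorem sum_response_toReal (P : Instance ι O) (i : ι) : ∑ x, (P.response i x).toReal = 1 := by
  rw [← ENNReal.toReal_sum fun x _ => (P.response i).apply_ne_top x,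
    ← tsum_fintype (L := .unconditional O), PMF.tsum_coe, ENNReal.toReal_one]

omit [Fintype ι] [DecidableEq ι] [Fintype O] [DecidableEq O] in
theorem response_lt_correct (P : Instance ι O) (i : ι) {z : O} (hz : z ≠ P.correct) :
    (P.response i z).toReal < (P.response i P.correct).toReal :=
  (ENNReal.toReal_lt_toReal ((P.response i).apply_ne_top _) ((P.response i).apply_ne_top _)).2
    (P.correct_unique i z hz)

omit [Fintype ι] [DecidableEq ι] [Fintype O] [DecidableEq O] in
theorem response_le_correct (P : Instance ι O) (i : ι) (z : O) :
    (P.response i z).toReal ≤ (P.response i P.correct).toReal := by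
  by_cases hz : z = P.correct
  · rw [hz]
  · exact (response_lt_correct P i hz).le

omit [Fintype ι] [DecidableEq ι] [DecidableEq O] in
theorem eps_pos (P : Instance ι O) (i : ι) : 0 < P.eps i := by
  obtain ⟨m, y, hm, hgap, hqm, hy⟩ := exists_second_value (fun x => (P.response i x).toReal)
    (fun x => ENNReal.toReal_nonneg) P.correct (response_le_correct P i)
  rw [Instance.eps, hgap]
  have hpos : 0 < (P.response i P.correct).toReal := by
    by_contra h
    have h0 : ∀ x, (P.response i x).toReal = 0 := fun x =>
      le_antisymm ((response_le_correct P i x).trans (not_lt.1 h)) ENNReal.toReal_nonneg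
    have := sum_response_toReal P i
    simp [h0] at this
  rcases hy with h | ⟨hne, h⟩
  · rw [h]; simpa using hpos
  · rw [← h]; exact sub_pos.2 (response_lt_correct P i hne)

omit [Fintype ι] [DecidableEq ι] [Fintype O] [DecidableEq O] in
theorem eps_le_one (P : Instance ι O) (i : ι) : P.eps i ≤ 1 := by
  have : Nonempty O := ⟨P.correct⟩
  refine gap_le_of_nonneg _ (fun x => ?_) fun x => ENNReal.toReal_nonneg
  exact ENNReal.toReal_le_of_le_ofReal zero_le_one (by simpa using PMF.coe_le_one _ _)

omit [Fintype ι] [DecidableEq ι] [DecidableEq O] in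
theorem reward_lt (P : Instance ι O) {i j : ι}
    (h : P.cost j / P.eps j ^ 2 < P.cost i / P.eps i ^ 2) : P.reward i < P.reward j := by
  have hi := P.cost_pos i
  have hj := P.cost_pos j
  have ei := eps_pos P i
  have ej := eps_pos P j
  unfold Instance.reward
  refine lt_of_pow_lt_pow_left₀ 2 (by positivity) ?_
  rw [div_pow, div_pow, Real.sq_sqrt hi.le, Real.sq_sqrt hj.le, div_lt_div_iff₀ hi hj]
  rw [div_lt_div_iff₀ (by positivity) (by positivity)] at h
  linarith

/-- The confidence radius in round `t` with `n` samples. -/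
noncomputable def radius (t n : ℕ) : ℝ := √(8 * Real.log t) / √n

theorem radius_nonneg (t n : ℕ) : 0 ≤ radius t n := by unfold radius; positivity

theorem radius_sq {t : ℕ} (n : ℕ) : radius t n ^ 2 = 8 * Real.log t / n := by
  rw [radius, div_pow, Real.sq_sqrt (by positivity [Real.log_natCast_nonneg t]),
    Real.sq_sqrt (Nat.cast_nonneg n)]

/-- In round `h.length + 1`, the empirical gap of crowd `i` is close to its gap. -/
def Accurate (P : Instance ι O) (h : History ι O) (i : ι) : Prop :=
  P.eps i - radius (h.length + 1) (numSamples h i) ≤ empGap h i ∧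
    empGap h i ≤ P.eps i + 3 * radius (h.length + 1) (numSamples h i)

omit [Fintype ι] [Fintype O] in
/-- If both empirical gaps are accurate, then the number of samples of a suboptimal crowd chosen
by UCB is bounded. -/
theorem numSamples_mul_le_of_accurate (hA : IsAlgUCB P A) {h : History ι O} {i j : ι}
    (hi : i ∈ (A h).support) (hNi : 1 ≤ numSamples h i) (hij : P.reward i < P.reward j)
    (hgi : Accurate P h i) (hgj : 1 ≤ numSamples h j → Accurate P h j) :
    numSamples h i * (P.cost i * (P.reward j - P.reward i) ^ 2) ≤
      128 * Real.log (h.length + 1 : ℕ) := by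
  have hle := hA h i hi j
  -- An unsampled crowd has index `⊤` and would beat the finite index of `i`.
  have hNj : numSamples h j ≠ 0 := by
    intro h0
    rw [ucbIndex, if_pos h0, top_le_iff, ucbIndex, if_neg (by omega)] at hle
    exact EReal.coe_ne_top _ hle
  rw [ucbIndex, ucbIndex, if_neg hNj, if_neg (by omega), EReal.coe_le_coe_iff] at hle
  change (√(P.cost j))⁻¹ * (empGap h j + radius (h.length + 1) (numSamples h j)) ≤
    (√(P.cost i))⁻¹ * (empGap h i + radius (h.length + 1) (numSamples h i)) at hle
  obtain ⟨hj1, -⟩ := hgj (Nat.one_le_iff_ne_zero.2 hNj)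
  obtain ⟨-, hi2⟩ := hgi
  set r := radius (h.length + 1) (numSamples h i) with hr
  have hci := P.cost_pos i
  have hcj := P.cost_pos j
  -- Accuracy puts the index of `j` above its reward, and that of `i` at most `(3 + 1) r / √(c i)`
  -- above its own. Squaring gives the constant `16 * 8 = 128`.
  have h1 : P.reward j ≤ P.reward i + 4 * r / √(P.cost i) := by
    have e1 : P.reward j = (√(P.cost j))⁻¹ * P.eps j := by rw [Instance.reward]; ring
    have e2 : P.reward i + 4 * r / √(P.cost i) = (√(P.cost i))⁻¹ * (P.eps i + 4 * r) := by
      rw [Instance.reward]; ring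
    rw [e1, e2]
    refine le_trans ?_ (hle.trans ?_)
    · gcongr; linarith
    · exact mul_le_mul_of_nonneg_left (by linarith) (by positivity)
  have h2 : (P.reward j - P.reward i) ^ 2 ≤ (4 * r / √(P.cost i)) ^ 2 :=
    pow_le_pow_left₀ (by linarith) (by linarith) 2
  have hN : (0 : ℝ) < numSamples h i := by exact_mod_cast hNi
  rw [div_pow, mul_pow, Real.sq_sqrt hci.le, hr, radius_sq, le_div_iff₀ hci, ← mul_div_assoc,
    le_div_iff₀ hN] at h2
  linarith

omit [Fintype ι] in
open Classical in
-- The sample size is random, so a union over its values `n ≤ k` is taken. The `8` in the radius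
-- turns the tail at fixed `n` into `11 n (k + 1)⁻⁴ ≤ 11 (k + 1)⁻³`, and `k` such terms are still
-- summable over the rounds.
theorem expect_not_accurate_le (i : ι) (k : ℕ) :
    expect (run P A S k) (fun s => if s.1.length = k ∧ 1 ≤ numSamples s.1 i ∧ ¬ Accurate P s.1 i
      then 1 else 0) ≤ ENNReal.ofReal (11 / (k + 1 : ℝ) ^ 2) := by
  set q : O → ℝ := fun x => (P.response i x).toReal with hq
  let G : ℕ → List O → ℝ := fun n l =>
    if gap q - radius (k + 1) n ≤ gap (empirical l) ∧
      gap (empirical l) ≤ gap q + 3 * radius (k + 1) n then 0 else 1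
  have hG : ∀ n l, 0 ≤ G n l := fun n l => by simp only [G]; split_ifs <;> norm_num
  have hterm : ∀ n ∈ Finset.Icc 1 k, expect (run P A S k) (fun s => if numSamples s.1 i = n then
      ENNReal.ofReal (G n (answersOf s.1 i)) else 0) ≤
      ENNReal.ofReal (11 / (k + 1 : ℝ) ^ 3) := by
    intro n hn
    rw [Finset.mem_Icc] at hn
    refine (expect_run_of_numSamples_eq_le i (hG n) n k).trans (ENNReal.ofReal_le_ofReal ?_)
    refine (sampleExp_gap_deviation_le (fun x => ENNReal.toReal_nonneg) (sum_response_toReal P i)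
      P.correct (response_le_correct P i) hn.1 (radius_nonneg (k + 1) n)).trans ?_
    have hnR : (0 : ℝ) < n := by exact_mod_cast hn.1
    have hk : (0 : ℝ) < k + 1 := by positivity
    have hnk : (n : ℝ) ≤ k + 1 := by exact_mod_cast hn.2.trans (Nat.le_succ k)
    have he : Real.exp (-(n * radius (k + 1) n ^ 2 / 2)) = ((k + 1 : ℝ) ^ 4)⁻¹ := by
      rw [radius_sq]
      have : (n : ℝ) * (8 * Real.log (k + 1 : ℕ) / n) / 2 = Real.log ((k + 1 : ℝ) ^ 4) := by
        rw [Real.log_pow]; push_cast; field_simp; ring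
      rw [this, Real.exp_neg, Real.exp_log (by positivity)]
    rw [he]
    calc 11 * (n : ℝ) * ((k + 1 : ℝ) ^ 4)⁻¹ ≤ 11 * (k + 1) * ((k + 1 : ℝ) ^ 4)⁻¹ := by gcongr
      _ = 11 / (k + 1 : ℝ) ^ 3 := by field_simp
  calc _ ≤ expect (run P A S k) (fun s => ∑ n ∈ Finset.Icc 1 k, if numSamples s.1 i = n then
        ENNReal.ofReal (G n (answersOf s.1 i)) else 0) := by
        refine expect_mono fun s => ?_
        split_ifs with hs
        · obtain ⟨hlen, hN, hacc⟩ := hs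
          have hmem : numSamples s.1 i ∈ Finset.Icc 1 k :=
            Finset.mem_Icc.2 ⟨hN, hlen ▸ numSamples_le_length _ _⟩
          refine le_trans ?_ (Finset.single_le_sum (fun n _ => zero_le) hmem)
          rw [if_pos rfl]
          have : G (numSamples s.1 i) (answersOf s.1 i) = 1 := by
            simp only [G]
            rw [if_neg]
            rw [Accurate, hlen] at hacc
            exact hacc
          simp [this]
        · exact zero_le
    _ ≤ ∑ n ∈ Finset.Icc 1 k, ENNReal.ofReal (11 / (k + 1 : ℝ) ^ 3) := by
        rw [expect_finsetSum]
        exact Finset.sum_le_sum hterm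
    _ = ENNReal.ofReal (k * (11 / (k + 1 : ℝ) ^ 3)) := by
        rw [Finset.sum_const, Nat.card_Icc, Nat.add_sub_cancel, nsmul_eq_mul,
          ENNReal.ofReal_mul (by positivity), ENNReal.ofReal_natCast]
    _ ≤ _ := by
        refine ENNReal.ofReal_le_ofReal ?_
        calc (k : ℝ) * (11 / (k + 1 : ℝ) ^ 3) ≤ (k + 1) * (11 / (k + 1 : ℝ) ^ 3) := by
              gcongr; linarith
          _ = 11 / (k + 1 : ℝ) ^ 2 := by field_simp

theorem sum_inv_succ_sq_le_two (n : ℕ) : ∑ k ∈ Finset.range n, 1 / (k + 1 : ℝ) ^ 2 ≤ 2 := by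
  -- The sharper bound telescopes.
  have h : ∀ n : ℕ, ∑ k ∈ Finset.range (n + 1), 1 / (k + 1 : ℝ) ^ 2 ≤ 2 - 1 / (n + 1 : ℝ) := by
    intro n
    induction n with
    | zero => norm_num
    | succ n ih =>
      rw [Finset.sum_range_succ]
      have : 1 / ((n + 1 : ℕ) + 1 : ℝ) ^ 2 ≤ 1 / (n + 1 : ℝ) - 1 / ((n + 1 : ℕ) + 1 : ℝ) := by
        push_cast
        rw [div_sub_div _ _ (by positivity) (by positivity),
          div_le_div_iff₀ (by positivity) (by positivity)]
        nlinarith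
      linarith
  rcases n with _ | n
  · simp
  · have : (0 : ℝ) ≤ 1 / (n + 1 : ℝ) := by positivity
    linarith [h n]

omit [Fintype ι] in
/-- The expected number of rounds in which UCB chooses a suboptimal crowd. -/
theorem expect_numSamples_suboptimal_le (hA : IsAlgUCB P A) {i j : ι}
    (hij : P.reward i < P.reward j) {R : SingleCrowdRule O} {T : ℕ} (hR : R.StopsBy T)
    (K : ℕ) :
    expect (run P A (compositeRule R) K) (fun s => (numSamples s.1 i : ℝ≥0∞)) ≤
      ENNReal.ofReal (128 * Real.log T / (P.cost i * (P.reward j - P.reward i) ^ 2) + 46) := by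
  classical
  set X := 128 * Real.log T / (P.cost i * (P.reward j - P.reward i) ^ 2) with hX
  have hw : 0 < P.cost i * (P.reward j - P.reward i) ^ 2 :=
    mul_pos (P.cost_pos i) (pow_pos (sub_pos.2 hij) 2)
  have hX0 : 0 ≤ X := div_nonneg (mul_nonneg (by norm_num) (Real.log_natCast_nonneg T)) hw.le
  set u : ℕ := ⌈X⌉₊ + 1 with hu
  let bad : ι → ℕ → History ι O × Bool → ℝ≥0∞ := fun i' k s =>
    if s.1.length = k ∧ 1 ≤ numSamples s.1 i' ∧ ¬ Accurate P s.1 i' then 1 else 0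
  -- The truncated excess `N i - u` grows only when `i` is chosen with `N i ≥ u > X`, which requires
  -- inaccuracy of `i` or `j`.
  have hstep : ∀ k, expect (run P A (compositeRule R) (k + 1))
      (fun s => ((numSamples s.1 i - u : ℕ) : ℝ≥0∞)) ≤
      expect (run P A (compositeRule R) k) (fun s => ((numSamples s.1 i - u : ℕ) : ℝ≥0∞)) +
        ENNReal.ofReal (22 / (k + 1 : ℝ) ^ 2) := by
    intro k
    calc _ ≤ expect (run P A (compositeRule R) k) (fun s =>
          ((numSamples s.1 i - u : ℕ) : ℝ≥0∞) + (bad i k s + bad j k s)) := by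
          rw [expect_run_succ]
          refine expect_mono_support fun s hs => ?_
          obtain ⟨h, b⟩ := s
          cases b with
          | true => rw [expect_step_true]; exact le_self_add
          | false =>
            obtain ⟨hlen, hkT⟩ := lt_of_not_stopped hR hs
            rw [expect_step_false, ← expect_const (A h) (_ + _)]
            refine expect_mono_support fun i' hi' => ?_
            by_cases hii : i' = i
            · subst hii
              simp only [numSamples_cons_self, expect_const]
              rcases lt_or_ge (numSamples h i') u with hN | hN
              · have : numSamples h i' + 1 - u = 0 := by omega
                simp [this]
              · have hbad : 1 ≤ bad i' k (h, false) + bad j k (h, false) := by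
                  by_contra hb
                  have hgi : Accurate P h i' := by
                    by_contra hacc
                    refine hb (le_trans ?_ le_self_add)
                    simp only [bad]
                    rw [if_pos ⟨hlen, by omega, hacc⟩]
                  have hgj : 1 ≤ numSamples h j → Accurate P h j := by
                    intro hNj
                    by_contra hacc
                    refine hb (le_trans ?_ le_add_self)
                    simp only [bad]
                    rw [if_pos ⟨hlen, hNj, hacc⟩]
                  have h1 := numSamples_mul_le_of_accurate hA hi' (by omega) hij hgi hgj
                  have h2 : Real.log (h.length + 1 : ℕ) ≤ Real.log T :=
                    Real.log_le_log (by positivity) (by exact_mod_cast (by omega))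
                  have h3 : (numSamples h i' : ℝ) ≤ X := by
                    rw [hX, le_div_iff₀ hw]; linarith
                  have h4 : (u : ℝ) ≤ numSamples h i' := by exact_mod_cast hN
                  have h5 := Nat.le_ceil X
                  rw [hu] at h4
                  push_cast at h4
                  linarith
                calc ((numSamples h i' + 1 - u : ℕ) : ℝ≥0∞)
                    ≤ ((numSamples h i' - u : ℕ) : ℝ≥0∞) + 1 := by exact_mod_cast (by omega)
                  _ ≤ _ := by gcongr
            · simp only [numSamples_cons_of_ne hii, expect_const]
              exact le_self_add
      _ ≤ _ := by
          rw [expect_add, expect_add]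
          gcongr
          have h1 := expect_not_accurate_le (P := P) (A := A) (S := compositeRule R) i k
          have h2 := expect_not_accurate_le (P := P) (A := A) (S := compositeRule R) j k
          refine (add_le_add h1 h2).trans ?_
          rw [← ENNReal.ofReal_add (by positivity) (by positivity)]
          refine ENNReal.ofReal_le_ofReal (le_of_eq ?_)
          ring
  have hsum : ∀ k, expect (run P A (compositeRule R) k)
      (fun s => ((numSamples s.1 i - u : ℕ) : ℝ≥0∞)) ≤
      ENNReal.ofReal (∑ k' ∈ Finset.range k, 22 / (k' + 1 : ℝ) ^ 2) := by
    intro k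
    induction k with
    | zero => rw [run, expect_pure]; simp [numSamples, answersOf]
    | succ k ih =>
      rw [Finset.sum_range_succ, ENNReal.ofReal_add
        (Finset.sum_nonneg fun _ _ => by positivity) (by positivity)]
      exact (hstep k).trans (by gcongr)
  have h44 : ∑ k' ∈ Finset.range K, 22 / (k' + 1 : ℝ) ^ 2 ≤ 44 := by
    have := sum_inv_succ_sq_le_two K
    have e : ∑ k' ∈ Finset.range K, 22 / (k' + 1 : ℝ) ^ 2 =
        22 * ∑ k' ∈ Finset.range K, 1 / (k' + 1 : ℝ) ^ 2 := by
      rw [Finset.mul_sum]; exact Finset.sum_congr rfl fun _ _ => by ring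
    linarith
  calc _ ≤ expect (run P A (compositeRule R) K)
        (fun s => (u : ℝ≥0∞) + ((numSamples s.1 i - u : ℕ) : ℝ≥0∞)) :=
        expect_mono fun s => by exact_mod_cast (by omega)
    _ ≤ ENNReal.ofReal u + ENNReal.ofReal 44 := by
        rw [expect_add, expect_const, ENNReal.ofReal_natCast]
        gcongr
        exact (hsum K).trans (ENNReal.ofReal_le_ofReal h44)
    -- `u ≤ X + 2`, whence `46 = 2 + 44`.
    _ ≤ _ := by
        rw [← ENNReal.ofReal_add (by positivity) (by norm_num)]
        refine ENNReal.ofReal_le_ofReal ?_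
        have := Nat.ceil_lt_add_one hX0
        rw [hu]; push_cast; linarith

omit [Fintype ι] [DecidableEq ι] [DecidableEq O] in
/-- The cost of a suboptimal crowd in terms of its contribution to `Λ`. -/
theorem cost_mul_bound_le {a b : ℝ} (ha : 0 < a) (hcost : ∀ i, a ≤ P.cost i ∧ P.cost i ≤ b)
    {i j : ι} (hij : P.reward i < P.reward j) {T : ℕ} (hT : 2 ≤ T) :
    P.cost i * (128 * Real.log T / (P.cost i * (P.reward j - P.reward i) ^ 2) + 46) ≤
      (128 * b ^ 2 + 67 * b ^ 3 / a) *
        (((P.cost i * (P.reward j - P.reward i)) ^ 2)⁻¹ * Real.log T) := by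
  obtain ⟨hca, hcb⟩ := hcost i
  have hc := P.cost_pos i
  have hb : 0 < b := hc.trans_le hcb
  set c := P.cost i with hcdef
  set D := P.reward j - P.reward i with hD
  have hD0 : 0 < D := sub_pos.2 hij
  have hlog2 := Real.log_two_gt_d9
  have hlogT : Real.log 2 ≤ Real.log T := Real.log_le_log (by norm_num) (by exact_mod_cast hT)
  -- Rewards lie in `[0, 1 / √a]`. This bounds each term of `Λ` from below, so that the additive
  -- `46` can be absorbed.
  have hD2 : D ^ 2 ≤ a⁻¹ := by
    have h1 : D ≤ (√a)⁻¹ := by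
      have hri : 0 ≤ P.reward i := div_nonneg (eps_pos P i).le (Real.sqrt_nonneg _)
      have hrj : P.reward j ≤ (√a)⁻¹ := by
        rw [Instance.reward, div_eq_mul_inv]
        have h2 : (√(P.cost j))⁻¹ ≤ (√a)⁻¹ :=
          inv_anti₀ (Real.sqrt_pos.2 ha) (Real.sqrt_le_sqrt (hcost j).1)
        exact (mul_le_of_le_one_left (by positivity) (eps_le_one P j)).trans h2
      linarith
    calc D ^ 2 ≤ ((√a)⁻¹) ^ 2 := pow_le_pow_left₀ hD0.le h1 2
      _ = a⁻¹ := by rw [inv_pow, Real.sq_sqrt ha.le]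
  have hinv : a / b ^ 2 ≤ ((c * D) ^ 2)⁻¹ := by
    rw [le_inv_comm₀ (by positivity) (by positivity), inv_div, mul_pow, div_eq_mul_inv]
    gcongr
  have e1 : c * (128 * Real.log T / (c * D ^ 2)) = 128 * c ^ 2 * (((c * D) ^ 2)⁻¹ * Real.log T) := by
    field_simp
  have h1 : c * (128 * Real.log T / (c * D ^ 2)) ≤
      128 * b ^ 2 * (((c * D) ^ 2)⁻¹ * Real.log T) := by
    rw [e1]
    have : 0 ≤ Real.log T := by linarith
    gcongr
  have h2 : c * 46 ≤ 67 * b ^ 3 / a * (((c * D) ^ 2)⁻¹ * Real.log T) := by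
    calc c * 46 ≤ b * (67 * Real.log T) := by
          -- `67 * log 2 > 46`; this is where `T ≥ 2` enters.
          have : (46 : ℝ) ≤ 67 * Real.log T := by linarith
          gcongr
      _ = 67 * b ^ 3 / a * (a / b ^ 2 * Real.log T) := by field_simp
      _ ≤ _ := by
          have : 0 ≤ Real.log T := by linarith
          gcongr
  rw [mul_add, add_mul]
  exact add_le_add h1 h2

end UCB

end BanditSurvey

/-! ### Assembly of the bounds, crowd by crowd. -/

theorem mainTheorem1 (a b : ℝ) (ha : 0 < a) (hab : a ≤ b) :
    ∃ K : ℝ, 0 < K ∧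
      ∀ (ι O : Type*) [Fintype ι] [DecidableEq ι] [Fintype O] [DecidableEq O]
        (P : BanditSurvey.Instance ι O) (_hcost : ∀ i, a ≤ P.cost i ∧ P.cost i ≤ b)
        (istar : ι)
        (_hstar : ∀ i, i ≠ istar →
          P.cost istar / P.eps istar ^ 2 < P.cost i / P.eps i ^ 2)
        (R₀ : BanditSurvey.SingleCrowdRule O) (_hsymm : R₀.Symmetric)
        (T : ℕ) (_hT : 2 ≤ T) (_hstop : R₀.StopsBy T)
        (AlgUCB : BanditSurvey.SelectionAlg ι O) (_hA : BanditSurvey.IsAlgUCB P AlgUCB),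
        BanditSurvey.costAlg P AlgUCB R₀ ≤
          BanditSurvey.costCrowd P istar R₀ +
            ENNReal.ofReal (K * (P.lam istar * Real.log T)) := by
  have hb : 0 < b := ha.trans_le hab
  refine ⟨128 * b ^ 2 + 67 * b ^ 3 / a, by positivity, ?_⟩
  intro ι O _ _ _ _ P hcost istar hstar R₀ _ T hT hR A hA
  have hrew : ∀ i, i ≠ istar → P.reward i < P.reward istar := fun i hi =>
    BanditSurvey.reward_lt P (hstar i hi)
  -- The number `n` of rounds considered also serves as the horizon of `remaining`, so both
  -- comparisons are finite.
  refine iSup_le fun n => ?_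
  change BanditSurvey.expect _ _ ≤ _
  have hcostsum : ∀ s : BanditSurvey.History ι O × Bool,
      ENNReal.ofReal (BanditSurvey.totalCost P s.1) =
        ∑ i, ENNReal.ofReal (P.cost i) * (BanditSurvey.numSamples s.1 i : ℝ≥0∞) := by
    intro s
    rw [BanditSurvey.totalCost_eq_sum, ENNReal.ofReal_sum_of_nonneg fun i _ =>
      mul_nonneg (P.cost_pos i).le (Nat.cast_nonneg _)]
    exact Finset.sum_congr rfl fun i _ => by
      rw [ENNReal.ofReal_mul (P.cost_pos i).le, ENNReal.ofReal_natCast]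
  simp only [hcostsum, BanditSurvey.expect_finsetSum, BanditSurvey.expect_const_mul]
  rw [← Finset.add_sum_erase _ _ (Finset.mem_univ istar)]
  refine add_le_add ?_ ?_
  · refine le_trans ?_ (BanditSurvey.cost_mul_remaining_le_costCrowd P istar R₀ n)
    gcongr
    exact BanditSurvey.expect_numSamples_le_remaining R₀ istar n
  · rw [BanditSurvey.Instance.lam, Finset.sum_mul, Finset.mul_sum,
      ENNReal.ofReal_sum_of_nonneg fun i _ => by
        have := Real.log_natCast_nonneg T
        positivity]
    refine Finset.sum_le_sum fun i hi => ?_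
    have hi' := hrew i (Finset.ne_of_mem_erase hi)
    refine le_trans ?_ (ENNReal.ofReal_le_ofReal
      (BanditSurvey.cost_mul_bound_le ha hcost hi' hT))
    rw [ENNReal.ofReal_mul (P.cost_pos i).le]
    gcongr
    exact BanditSurvey.expect_numSamples_suboptimal_le hA hi' hR n
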